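/- Let $n$ be a natural number, let $\mathbb F_q$ be a finite field of characteristic different from $2$, and fix a nontrivial character $t\mapsto\varepsilon^t$ of the additive group of $\mathbb F_q$ with values in $\mathbb C^*$. Let $\mathfrak b$ be the algebra of upper triangular $n\times n$ matrices over $\mathbb F_q$, let $\mathfrak n\subset\mathfrak b$ be the strictly upper triangular ones, and let $\mathfrak n^*$ be the dual space, with the left and right actions $(t\lambda)(x)=\lambda(xt)$, $(\lambda t)(x)=\lambda(tx)$ of $t\in\mathfrak b$. Let $\mathfrak g^a=\mathfrak b\oplus\mathfrak n^*$ be the associative algebra with the multiplication $(t_1+\lambda_1)(t_2+\lambda_2)=t_1t_2+t_1\lambda_2+\lambda_1t_2$, let $\mathfrak U=\mathfrak n\oplus\mathfrak n^*$, and let $U^a=1+\mathfrak U$, a subgroup of the group of invertible elements of $\mathfrak g^a$. Denote by $E_{ij}$ ($i<j$) the matrix units in $\mathfrak n$ and by $F_{ij}$ ($i>j$) the basis of $\mathfrak n^*$ with $F_{ij}(E_{km})=\delta_{jk}\delta_{im}$, and define a bilinear form on $\mathfrak U$ by $(x_1+\lambda_1,x_2+\lambda_2)=\lambda_2(x_1)+\lambda_1(x_2)$.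 A root is a pair $(i,j)$ with $1\le i,j\le n$, $i\ne j$. A rook placement $D$ is a set of roots with at most one root in any row and at most one root in any column. Consider the pairs $(D,\phi)$, where $D$ is a rook placement and $\phi:D\to\mathbb F_q^*$ is a map. Put $$X_{D,\phi}=\sum_{\gamma\in D,\ \gamma=(i,j),\ i<j}\phi(\gamma)E_{ij}+\sum_{\gamma\in D,\ \gamma=(i,j),\ i>j}\phi(\gamma)F_{ij},\qquad K_{D,\phi}=1+U^aX_{D,\phi}U^a .$$ Let $D^t=\{(j,i):(i,j)\in D\}$, $\phi^t(j,i)=\phi(i,j)$, and $\Lambda_{D,\phi}(Y)=(X_{D^t,\phi^t},Y)$ for $Y\in\mathfrak U$. For a root $\gamma=(i,j)$ let $S(\gamma)=\{(i,k): i<k<j\}$ if $i<j$, and $S(\gamma)=\{(i,k): k<j\}\cup\{(i,k): k>i\}$ if $i>j$. Let $\mathfrak U_D\subset\mathfrak U$ be the span of those basis elements $E_\beta$, $F_\beta$ for which $\beta\notin\bigcup_{\gamma\in D}S(\gamma)$. Then $U_D=1+\mathfrak U_D$ is a subgroup of $U^a$, and $\xi_{D,\phi}(1+X)=\varepsilon^{\Lambda_{D,\phi}(X)}$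 is a linear character of it. Let $\chi_{D,\phi}=\mathrm{Ind}_{U_D}^{U^a}\xi_{D,\phi}$. Then the systems $\{\chi_{D,\phi}\}$ and $\{K_{D,\phi}\}$, both indexed by all pairs $(D,\phi)$, form a supercharacter theory of $U^a$: the $\chi_{D,\phi}$ are characters of nonzero complex representations of $U^a$; the sets $K_{D,\phi}$ are nonempty, pairwise disjoint for distinct pairs $(D,\phi)$, and cover $U^a$; the characters $\chi_{D,\phi}$ and $\chi_{D',\phi'}$ are orthogonal for $(D,\phi)\ne(D',\phi')$; each $\chi_{D,\phi}$ is constant on each $K_{D',\phi'}$; and $\{1\}$ is one of the sets $K_{D,\phi}$. -/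

import Mathlib

/-!
The Borel contraction of `gl(n, K)`, its unipotent group `U^a`, rook placements, and the
characters and subsets of `U^a` attached to them.  Roots are pairs `(i, j)` with `i ≠ j` in
`Fin n`, i.e. row and column numbers run through `0, …, n - 1`.
-/

section SupercharacterTheory

/-- `χ` is the character of a nonzero finite dimensional complex representation of `G`. -/
def IsComplexCharacter {G : Type*} [Group G] (χ : G → ℂ) : Prop :=
  ∃ d : ℕ, 0 < d ∧ ∃ ρ : Representation ℂ G (Fin d → ℂ), ρ.character = χ

/-- The Hermitian inner product of complex functions on a finite group. -/
noncomputable def characterInner {G : Type*} [Fintype G] (χ ψ : G → ℂ) : ℂ :=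
  (Fintype.card G : ℂ)⁻¹ * ∑ g : G, χ g * (starRingEnd ℂ) (ψ g)

/-- A supercharacter theory of a finite group `G`: a system of complex characters and a partition
of `G`, with the same number of members (they share the index type `ι`), such that the characters
are pairwise orthogonal, each character is constant on each part, and `{1}` is a part.
Distinct indices give distinct parts (nonempty and disjoint) and distinct characters
(nonzero and orthogonal). -/
structure IsSupercharacterTheory {G : Type*} [Group G] [Fintype G] {ι : Type*}
    (χ : ι → G → ℂ) (P : ι → Set G) : Prop where
  isCharacter : ∀ i, IsComplexCharacter (χ i)
  nonempty : ∀ i, (P i).Nonempty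
  disjoint : Pairwise fun i j => Disjoint (P i) (P j)
  cover : ⋃ i, P i = Set.univ
  orthogonal : Pairwise fun i j => characterInner (χ i) (χ j) = 0
  constant : ∀ i j, ∀ g ∈ P j, ∀ h ∈ P j, χ i g = χ i h
  one : ∃ j, P j = {1}

end SupercharacterTheory

section Contraction

/-- The component of a matrix in the algebra `b` of upper triangular matrices. -/
def upperPart {n : ℕ} {K : Type*} [Field K] :
    Matrix (Fin n) (Fin n) K →ₗ[K] Matrix (Fin n) (Fin n) K where
  toFun X := Matrix.of fun i j => if i ≤ j then X i j else 0
  map_add' X Y := by ext i j; by_cases h : i ≤ j <;> simp [h]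
  map_smul' c X := by ext i j; by_cases h : i ≤ j <;> simp [h]

/-- The component of a matrix in the space `n_-` of strictly lower triangular matrices. -/
def lowerPart {n : ℕ} {K : Type*} [Field K] :
    Matrix (Fin n) (Fin n) K →ₗ[K] Matrix (Fin n) (Fin n) K where
  toFun X := Matrix.of fun i j => if j < i then X i j else 0
  map_add' X Y := by ext i j; by_cases h : j < i <;> simp [h]
  map_smul' c X := by ext i j; by_cases h : j < i <;> simp [h]

theorem upperPart_apply {n : ℕ} {K : Type*} [Field K] (X : Matrix (Fin n) (Fin n) K)
    (i j : Fin n) : upperPart X i j = if i ≤ j then X i j else 0 := rfl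

theorem lowerPart_apply {n : ℕ} {K : Type*} [Field K] (X : Matrix (Fin n) (Fin n) K)
    (i j : Fin n) : lowerPart X i j = if j < i then X i j else 0 := rfl

theorem upperPart_add_lowerPart {n : ℕ} {K : Type*} [Field K] (X : Matrix (Fin n) (Fin n) K) :
    upperPart X + lowerPart X = X := by
  ext i j
  by_cases h : i ≤ j
  · simp [upperPart_apply, lowerPart_apply, h, not_lt.mpr h]
  · simp [upperPart_apply, lowerPart_apply, h, not_le.mp h]

/-- The Borel contraction of `gl(n, K)`: the space `b ⊕ n^*`, where `n^*` is identified with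
`n_-` by `λ(x) = tr(λ x)`, so that the underlying space is that of all `n × n` matrices.
The multiplication below is not the matrix multiplication. -/
def BorelContraction (n : ℕ) (K : Type*) : Type _ := Matrix (Fin n) (Fin n) K

namespace BorelContraction

variable {n : ℕ} {K : Type*} [Field K]

instance : AddCommGroup (BorelContraction n K) :=
  inferInstanceAs (AddCommGroup (Matrix (Fin n) (Fin n) K))

instance : Module K (BorelContraction n K) :=
  inferInstanceAs (Module K (Matrix (Fin n) (Fin n) K))

instance [Finite K] : Finite (BorelContraction n K) :=
  inferInstanceAs (Finite (Matrix (Fin n) (Fin n) K))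

/-- The underlying matrix; its entry at `(i, j)` is the coefficient of `E_ij` if `i ≤ j`, and of
`F_ij` if `i > j`. -/
def toMatrix : BorelContraction n K ≃ₗ[K] Matrix (Fin n) (Fin n) K :=
  LinearEquiv.refl K (Matrix (Fin n) (Fin n) K)

/-- `(t₁ + λ₁)(t₂ + λ₂) = t₁ t₂ + t₁ λ₂ + λ₁ t₂` for `tᵢ ∈ b` and `λᵢ ∈ n^*`.  Here
`(t λ)(x) = λ(x t)` and `(λ t)(x) = λ(t x)` for `x` strictly upper triangular; under
`n^* = n_-` these are the strictly lower triangular parts of the matrix products. -/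
instance : Mul (BorelContraction n K) where
  mul X Y := toMatrix.symm
    (upperPart (toMatrix X) * upperPart (toMatrix Y) +
      lowerPart (upperPart (toMatrix X) * lowerPart (toMatrix Y) +
        lowerPart (toMatrix X) * upperPart (toMatrix Y)))

instance : One (BorelContraction n K) where
  one := toMatrix.symm 1

theorem toMatrix_mul (X Y : BorelContraction n K) : toMatrix (X * Y) =
    upperPart (toMatrix X) * upperPart (toMatrix Y) +
      lowerPart (upperPart (toMatrix X) * lowerPart (toMatrix Y) +
        lowerPart (toMatrix X) * upperPart (toMatrix Y)) := rfl

theorem toMatrix_one : toMatrix (1 : BorelContraction n K) = 1 := rfl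

/-- Multiplication in coordinates. -/
theorem toMatrix_mul_apply (X Y : BorelContraction n K) (i j : Fin n) :
    toMatrix (X * Y) i j = ∑ k : Fin n,
      if (i ≤ k ∧ k ≤ j) ∨ (j < i ∧ (i ≤ k ∨ k ≤ j)) then
        toMatrix X i k * toMatrix Y k j else 0 := by
  rw [toMatrix_mul, Matrix.add_apply, lowerPart_apply, Matrix.add_apply, Matrix.mul_apply,
    Matrix.mul_apply, Matrix.mul_apply]
  simp only [upperPart_apply, lowerPart_apply]
  by_cases h : j < i
  · rw [if_pos h, ← Finset.sum_add_distrib, ← Finset.sum_add_distrib]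
    refine Finset.sum_congr rfl fun k _ => ?_
    split_ifs <;> first | (exfalso; omega) | simp
  · rw [if_neg h, add_zero]
    refine Finset.sum_congr rfl fun k _ => ?_
    split_ifs <;> first | (exfalso; omega) | simp

instance : Ring (BorelContraction n K) :=
  { (inferInstance : AddCommGroup (BorelContraction n K)),
    (inferInstance : Mul (BorelContraction n K)),
    (inferInstance : One (BorelContraction n K)) with
    left_distrib := fun X Y Z => by
      apply toMatrix.injective
      simp only [map_add, toMatrix_mul, mul_add]
      abel
    right_distrib := fun X Y Z => by
      apply toMatrix.injective
      simp only [map_add, toMatrix_mul, add_mul]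
      abel
    zero_mul := fun X => by
      apply toMatrix.injective
      simp only [map_zero, toMatrix_mul, zero_mul, add_zero]
    mul_zero := fun X => by
      apply toMatrix.injective
      simp only [map_zero, toMatrix_mul, mul_zero, add_zero]
    one_mul := fun X => by
      apply toMatrix.injective
      ext i j
      rw [toMatrix_mul_apply, Finset.sum_eq_single i]
      · rw [if_pos (by omega), toMatrix_one, Matrix.one_apply_eq, one_mul]
      · intro k _ hk
        simp [toMatrix_one, Matrix.one_apply_ne hk.symm]
      · simp
    mul_one := fun X => by
      apply toMatrix.injective
      ext i j
      rw [toMatrix_mul_apply, Finset.sum_eq_single j]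
      · rw [if_pos (by omega), toMatrix_one, Matrix.one_apply_eq, mul_one]
      · intro k _ hk
        simp [toMatrix_one, Matrix.one_apply_ne hk]
      · simp
    mul_assoc := fun X Y Z => by
      apply toMatrix.injective
      ext i j
      simp only [toMatrix_mul_apply, Finset.sum_mul, Finset.mul_sum, ← Finset.sum_filter]
      simp only [Finset.sum_filter]
      have hl : ∀ (p : Prop) [Decidable p] (f : Fin n → K),
          (if p then ∑ b, f b else 0) = ∑ b, if p then f b else 0 := by
        intro p _ f
        split_ifs <;> simp
      simp only [hl]
      rw [Finset.sum_comm]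
      refine Finset.sum_congr rfl fun b _ => Finset.sum_congr rfl fun a _ => ?_
      simp only [← ite_and, mul_assoc]
      exact if_congr (by omega) rfl rfl }

/-- The radical `𝔘 = n + n^*`: the elements with zero diagonal. -/
def radical (n : ℕ) (K : Type*) [Field K] : Submodule K (BorelContraction n K) where
  carrier := {X | ∀ i, toMatrix X i i = 0}
  add_mem' := fun {X Y} hX hY i => by simp [hX i, hY i]
  zero_mem' := fun i => by simp
  smul_mem' := fun c X hX i => by simp [hX i]

theorem radical_mul_mem (X Y : BorelContraction n K) (hX : X ∈ radical n K) :
    X * Y ∈ radical n K := by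
  intro i
  rw [toMatrix_mul_apply]
  refine Finset.sum_eq_zero fun k _ => ?_
  split_ifs with h
  · obtain rfl : k = i := by omega
    rw [hX k, zero_mul]
  · rfl

/-- The group `U^a = 1 + 𝔘`, as a subgroup of the group of invertible elements of the Borel
contraction. -/
def unipotentGroup (n : ℕ) (K : Type*) [Field K] : Subgroup (BorelContraction n K)ˣ where
  carrier := {u | (u : BorelContraction n K) - 1 ∈ radical n K}
  one_mem' := by simp
  mul_mem' := fun {u v} hu hv => by
    have h : ((u * v : (BorelContraction n K)ˣ) : BorelContraction n K) - 1 =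
        ((u : BorelContraction n K) - 1) * v + ((v : BorelContraction n K) - 1) := by
      rw [Units.val_mul]; noncomm_ring
    simp only [Set.mem_ofPred_eq, h]
    exact add_mem (radical_mul_mem _ _ hu) hv
  inv_mem' := fun {u} hu => by
    have h : ((u⁻¹ : (BorelContraction n K)ˣ) : BorelContraction n K) - 1 =
        -(((u : BorelContraction n K) - 1) * (u⁻¹ : (BorelContraction n K)ˣ)) := by
      rw [sub_mul, Units.mul_inv]; noncomm_ring
    simp only [Set.mem_ofPred_eq, h]
    exact neg_mem (radical_mul_mem _ _ hu)

/-- The element `X` of `𝔘` with `u = 1 + X`, for `u ∈ U^a`. -/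
def nilPart (u : unipotentGroup n K) : BorelContraction n K :=
  ((u : (BorelContraction n K)ˣ) : BorelContraction n K) - 1

theorem nilPart_mem (u : unipotentGroup n K) : nilPart u ∈ radical n K := u.2

theorem nilPart_one : nilPart (1 : unipotentGroup n K) = 0 := by simp [nilPart]

theorem nilPart_mul (u v : unipotentGroup n K) :
    nilPart (u * v) = nilPart u + nilPart v + nilPart u * nilPart v := by
  simp only [nilPart, Subgroup.coe_mul, Units.val_mul]
  noncomm_ring

noncomputable instance [Finite K] : Fintype (unipotentGroup n K) := Fintype.ofFinite _

/-- The symmetric bilinear form `(x₁ + λ₁, x₂ + λ₂) = λ₂(x₁) + λ₁(x₂)` (on `𝔘`). -/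
def form (X Y : BorelContraction n K) : K :=
  (lowerPart (toMatrix Y) * upperPart (toMatrix X)).trace +
    (lowerPart (toMatrix X) * upperPart (toMatrix Y)).trace

theorem form_eq_sum (X Y : BorelContraction n K) : form X Y =
    ∑ i, ∑ j, if i ≠ j then toMatrix X i j * toMatrix Y j i else 0 := by
  have h1 : (lowerPart (toMatrix Y) * upperPart (toMatrix X)).trace =
      ∑ i, ∑ j, lowerPart (toMatrix Y) j i * upperPart (toMatrix X) i j := by
    simp only [Matrix.trace, Matrix.diag, Matrix.mul_apply]
    exact Finset.sum_comm
  rw [form, h1]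
  simp only [Matrix.trace, Matrix.diag, Matrix.mul_apply, ← Finset.sum_add_distrib,
    upperPart_apply, lowerPart_apply]
  refine Finset.sum_congr rfl fun i _ => Finset.sum_congr rfl fun j _ => ?_
  rcases lt_trichotomy i j with h | rfl | h
  · simp [h, h.le, h.ne, not_lt.mpr h.le, mul_comm]
  · simp
  · simp [h, h.le, h.ne', not_lt.mpr h.le]

/-- The superclass `1 + U^a X U^a`. -/
def superclass (X : BorelContraction n K) : Set (unipotentGroup n K) :=
  {g | ∃ a b : unipotentGroup n K,
    nilPart g = (a : (BorelContraction n K)ˣ) * X * (b : (BorelContraction n K)ˣ)}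

end BorelContraction

end Contraction

section RookPlacements

/-- A rook placement: a set of roots `(i, j)`, `i ≠ j`, with at most one root in any row and at
most one root in any column. -/
structure RookPlacement (n : ℕ) where
  roots : Finset (Fin n × Fin n)
  ne : ∀ γ ∈ roots, γ.1 ≠ γ.2
  row_inj : ∀ γ ∈ roots, ∀ δ ∈ roots, γ.1 = δ.1 → γ = δ
  col_inj : ∀ γ ∈ roots, ∀ δ ∈ roots, γ.2 = δ.2 → γ = δ

/-- A pair `(D, φ)`: a rook placement `D` with a map `φ : D → K^*`. -/
structure RookDatum (n : ℕ) (K : Type*) [Field K] where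
  D : RookPlacement n
  φ : {γ // γ ∈ D.roots} → Kˣ

/-- The rook placement `D^t`, consisting of the opposite roots `(j, i)` of the `(i, j) ∈ D`. -/
def RookPlacement.transpose {n : ℕ} (D : RookPlacement n) : RookPlacement n where
  roots := D.roots.map (Equiv.prodComm (Fin n) (Fin n)).toEmbedding
  ne := by
    intro γ hγ
    obtain ⟨δ, hδ, rfl⟩ := Finset.mem_map.mp hγ
    exact (D.ne δ hδ).symm
  row_inj := by
    intro γ hγ γ' hγ' h
    obtain ⟨δ, hδ, rfl⟩ := Finset.mem_map.mp hγ
    obtain ⟨δ', hδ', rfl⟩ := Finset.mem_map.mp hγ'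
    exact congrArg _ (D.col_inj δ hδ δ' hδ' h)
  col_inj := by
    intro γ hγ γ' hγ' h
    obtain ⟨δ, hδ, rfl⟩ := Finset.mem_map.mp hγ
    obtain ⟨δ', hδ', rfl⟩ := Finset.mem_map.mp hγ'
    exact congrArg _ (D.row_inj δ hδ δ' hδ' h)

theorem RookPlacement.swap_mem {n : ℕ} (D : RookPlacement n) {γ : Fin n × Fin n}
    (h : γ ∈ D.transpose.roots) : γ.swap ∈ D.roots := by
  obtain ⟨δ, hδ, rfl⟩ := Finset.mem_map.mp h
  exact hδ

/-- The set `S(γ)` of roots.  For `γ = (i, j)` with `i < j` it consists of the `(i, k)` with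
`i < k < j`; for `i > j` it consists of the `(i, k)` with `k < j` and the `(i, k)` with `i < k`. -/
def rootArm {n : ℕ} (γ : Fin n × Fin n) : Set (Fin n × Fin n) :=
  {α | α.1 = γ.1 ∧
    ((γ.1 < γ.2 ∧ γ.1 < α.2 ∧ α.2 < γ.2) ∨ (γ.2 < γ.1 ∧ (α.2 < γ.2 ∨ γ.1 < α.2)))}

namespace RookPlacement

open BorelContraction

variable {n : ℕ} {K : Type*} [Field K]

/-- The subspace `𝔘_D = ⋂_{γ ∈ D} 𝔘_γ`, where `𝔘_γ` is spanned by the matrix units `E_β`, `F_β`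
of `𝔘` with `β ∉ S(γ)`. -/
def radicalSub (D : RookPlacement n) (K : Type*) [Field K] :
    Submodule K (BorelContraction n K) where
  carrier := {X | X ∈ radical n K ∧
    ∀ γ ∈ D.roots, ∀ α ∈ rootArm γ, toMatrix X α.1 α.2 = 0}
  add_mem' := fun {X Y} hX hY => ⟨add_mem hX.1 hY.1, fun γ hγ α hα => by
    simp [hX.2 γ hγ α hα, hY.2 γ hγ α hα]⟩
  zero_mem' := ⟨zero_mem _, fun γ _ α _ => by simp⟩
  smul_mem' := fun c X hX => ⟨Submodule.smul_mem _ c hX.1, fun γ hγ α hα => by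
    simp [hX.2 γ hγ α hα]⟩

theorem radicalSub_mul_mem (D : RookPlacement n) (X Y : BorelContraction n K)
    (hX : X ∈ D.radicalSub K) : X * Y ∈ D.radicalSub K := by
  refine ⟨radical_mul_mem _ _ hX.1, fun γ hγ α hα => ?_⟩
  rw [toMatrix_mul_apply]
  refine Finset.sum_eq_zero fun k _ => ?_
  split_ifs with h
  · by_cases hk : k = α.1
    · rw [hk, hX.1 α.1, zero_mul]
    · have hm : (α.1, k) ∈ rootArm γ := by
        obtain ⟨h1, h2⟩ := hα
        refine ⟨h1, ?_⟩
        simp only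
        omega
      rw [hX.2 γ hγ _ hm, zero_mul]
  · rfl

theorem mul_apply_eq_zero (D : RookPlacement n) {X Y : BorelContraction n K}
    (hX : X ∈ D.radicalSub K) (hY : Y ∈ radical n K) {γ : Fin n × Fin n} (hγ : γ ∈ D.roots) :
    toMatrix (X * Y) γ.1 γ.2 = 0 := by
  rw [toMatrix_mul_apply]
  refine Finset.sum_eq_zero fun k _ => ?_
  split_ifs with h
  · by_cases hk : k = γ.1
    · rw [hk, hX.1 γ.1, zero_mul]
    by_cases hk' : k = γ.2
    · rw [hk', hY γ.2, mul_zero]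
    have hm : (γ.1, k) ∈ rootArm γ := by
      refine ⟨rfl, ?_⟩
      have := D.ne γ hγ
      simp only
      omega
    rw [hX.2 γ hγ _ hm, zero_mul]
  · rfl

/-- The subgroup `U_D = 1 + 𝔘_D` of `U^a`. -/
def subgroup (D : RookPlacement n) (K : Type*) [Field K] : Subgroup (unipotentGroup n K) where
  carrier := {u | nilPart u ∈ D.radicalSub K}
  one_mem' := by simp [nilPart_one]
  mul_mem' := fun {u v} hu hv => by
    simp only [Set.mem_ofPred_eq, nilPart_mul]
    exact add_mem (add_mem hu hv) (radicalSub_mul_mem D _ _ hu)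
  inv_mem' := fun {u} hu => by
    have h : nilPart u⁻¹ = -(nilPart u + nilPart u * nilPart u⁻¹) := by
      have := nilPart_mul u u⁻¹
      rw [mul_inv_cancel, nilPart_one] at this
      rw [eq_neg_iff_add_eq_zero, this]
      abel
    simp only [Set.mem_ofPred_eq]
    rw [h]
    exact neg_mem (add_mem hu (radicalSub_mul_mem D _ _ hu))

end RookPlacement

namespace RookDatum

open BorelContraction

variable {n : ℕ} {K : Type*} [Field K]

/-- The datum `(D^t, φ^t)` with `φ^t(γ) = φ(γ^t)`. -/
def transpose (d : RookDatum n K) : RookDatum n K where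
  D := d.D.transpose
  φ γ := d.φ ⟨γ.1.swap, d.D.swap_mem γ.2⟩

/-- The element `X_{D,φ} = ∑_{γ ∈ D_+} φ(γ) E_γ + ∑_{γ ∈ D_-} φ(γ) F_γ`. -/
def element (d : RookDatum n K) : BorelContraction n K :=
  ∑ γ : {γ // γ ∈ d.D.roots}, toMatrix.symm (Matrix.single γ.1.1 γ.1.2 (d.φ γ : K))

/-- The linear form `Λ_{D,φ}(Y) = (X_{D^t,φ^t}, Y)`. -/
def functional (d : RookDatum n K) (Y : BorelContraction n K) : K :=
  form d.transpose.element Y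

theorem form_element (d : RookDatum n K) (Y : BorelContraction n K) :
    form d.element Y =
      ∑ γ : {γ // γ ∈ d.D.roots}, (d.φ γ : K) * toMatrix Y γ.1.2 γ.1.1 := by
  simp only [form_eq_sum, element, map_sum, LinearEquiv.apply_symm_apply, Matrix.sum_apply,
    Finset.sum_mul, ← Finset.sum_filter]
  have hl : ∀ (i : Fin n) , (∑ j ∈ Finset.univ.filter (fun j => i ≠ j),
      ∑ γ : {γ // γ ∈ d.D.roots},
        Matrix.single γ.1.1 γ.1.2 (d.φ γ : K) i j * toMatrix Y j i) =
      ∑ γ : {γ // γ ∈ d.D.roots}, ∑ j ∈ Finset.univ.filter (fun j => i ≠ j),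
        Matrix.single γ.1.1 γ.1.2 (d.φ γ : K) i j * toMatrix Y j i :=
    fun i => Finset.sum_comm
  simp only [hl]
  rw [Finset.sum_comm]
  refine Finset.sum_congr rfl fun γ _ => ?_
  rw [Finset.sum_eq_single γ.1.1, Finset.sum_eq_single γ.1.2]
  · simp
  · intro j _ hj
    simp [hj.symm]
  · intro h
    exact absurd (by simpa using h) (d.D.ne _ γ.2)
  · intro i _ hi
    refine Finset.sum_eq_zero fun j _ => ?_
    simp [hi.symm]
  · simp

theorem functional_add (d : RookDatum n K) (Y Z : BorelContraction n K) :
    d.functional (Y + Z) = d.functional Y + d.functional Z := by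
  simp only [functional, form_element, map_add, Matrix.add_apply, mul_add,
    Finset.sum_add_distrib]

theorem functional_mul (d : RookDatum n K) {X Y : BorelContraction n K}
    (hX : X ∈ d.D.radicalSub K) (hY : Y ∈ radical n K) : d.functional (X * Y) = 0 := by
  rw [functional, form_element]
  refine Finset.sum_eq_zero fun γ _ => ?_
  have h := d.D.mul_apply_eq_zero hX hY (d.D.swap_mem γ.2)
  simp only [Prod.fst_swap, Prod.snd_swap] at h
  rw [h, mul_zero]

/-- The linear character `ξ_{D,φ}(1 + X) = ε^{Λ_{D,φ}(X)}` of `U_D`. -/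
def linearCharacter (ε : AddChar K ℂ) (d : RookDatum n K) : d.D.subgroup K →* ℂ where
  toFun u := ε (d.functional (nilPart (u : unipotentGroup n K)))
  map_one' := by
    have h : d.functional 0 = 0 := by
      have := d.functional_add 0 0
      simpa using this
    simp [nilPart_one, h]
  map_mul' u v := by
    rw [Subgroup.coe_mul, nilPart_mul, functional_add, functional_add,
      d.functional_mul u.2 (nilPart_mem _), add_zero, AddChar.map_add_eq_mul]

/-- The character `χ_{D,φ}` of `U^a`: the character of the representation induced from the one
dimensional representation of `U_D` on `ℂ` given by `ξ_{D,φ}`. -/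
noncomputable def character (ε : AddChar K ℂ) (d : RookDatum n K) : unipotentGroup n K → ℂ :=
  (Representation.ind (d.D.subgroup K).subtype
    ((Algebra.lmul ℂ ℂ : ℂ →* Module.End ℂ ℂ).comp (d.linearCharacter ε) :
      Representation ℂ (d.D.subgroup K) ℂ)).character

/-- The class `K_{D,φ} = 1 + U^a X_{D,φ} U^a`, the superclass of `u_{D,φ} = 1 + X_{D,φ}`. -/
def superclass (d : RookDatum n K) : Set (unipotentGroup n K) :=
  BorelContraction.superclass d.element

end RookDatum

end RookPlacements

/-! Let the length of a position `(i, j)` be the residue of `j - i` modulo `n`. Two matrix units at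
`(i, k)` and `(k, j)` multiply in the contraction as ordinary matrix units when their lengths add up
to the length of `(i, j)`, and to zero otherwise. The contraction thus behaves like a triangular
algebra wound around a cycle, and the arguments for upper and lower positions merge into inductions
on length.

Superclasses. Row and column operations from `U^a` use a nonzero entry to clear longer entries of
its row and column, so each two-sided orbit in the radical contains a rook matrix
(`exists_inOrbit_isRookMatrix`). Comparing two rook matrices in one orbit from short to long
positions shows that they agree (`IsRookMatrix.eq_of_mul_eq`). The same comparison from long to
short positions separates the orbits of linear forms (`IsRookMatrix.eq_of_dual_mul_eq`).

Characters. `𝔘_D` is exactly the set of `X` in the radical with `Λ(X Y) = 0` for all `Y` in the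
radical. Hence `ξ`, extended by zero, is an average of `ε ∘ Λ` over right translates, and the
Frobenius formula makes `χ` a multiple of the sum of `ε(Λ(x X y))` over all `x, y` in `U^a`
(`character_eq_sum`). Constancy on superclasses follows by reindexing. Orthogonality follows because
forms in different orbits have a nonzero difference, over which `ε` sums to zero. -/

/-! ### Cyclic lengths of positions -/

section CyclicLength

/-- The length of the cyclic interval from `i` to `j`, i.e. the residue of `j - i` modulo `n`. -/
def cyclicLength {n : ℕ} (i j : Fin n) : ℕ :=
  if i ≤ j then (j : ℕ) - i else n + j - i

variable {n : ℕ}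

theorem cyclicLength_lt (i j : Fin n) : cyclicLength i j < n := by
  unfold cyclicLength
  split_ifs <;> omega

@[simp]
theorem cyclicLength_self (i : Fin n) : cyclicLength i i = 0 := by
  simp [cyclicLength]

theorem cyclicLength_eq_zero {i j : Fin n} (h : cyclicLength i j = 0) : i = j := by
  unfold cyclicLength at h
  split_ifs at h <;> omega

theorem cyclicLength_left_inj {i j k : Fin n} (h : cyclicLength i k = cyclicLength j k) :
    i = j := by
  unfold cyclicLength at h
  split_ifs at h <;> omega

theorem cyclicLength_right_inj {i j k : Fin n} (h : cyclicLength i j = cyclicLength i k) :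
    j = k := by
  unfold cyclicLength at h
  split_ifs at h <;> omega

/-- The right side is the condition under which a term survives in `toMatrix_mul_apply`. It says
that `k` lies on the cyclic arc from `i` to `j`. -/
theorem cyclicLength_add_iff (i k j : Fin n) :
    cyclicLength i k + cyclicLength k j = cyclicLength i j ↔
      (i ≤ k ∧ k ≤ j) ∨ (j < i ∧ (i ≤ k ∨ k ≤ j)) := by
  unfold cyclicLength
  split_ifs <;> omega

theorem cyclicLength_add_of_le_left {i k j : Fin n} (h : cyclicLength i k ≤ cyclicLength i j) :
    cyclicLength i k + cyclicLength k j = cyclicLength i j := by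
  unfold cyclicLength at h ⊢
  split_ifs at h ⊢ <;> omega

theorem cyclicLength_add_of_le_right {i k j : Fin n} (h : cyclicLength k j ≤ cyclicLength i j) :
    cyclicLength i k + cyclicLength k j = cyclicLength i j := by
  unfold cyclicLength at h ⊢
  split_ifs at h ⊢ <;> omega

/-- In this form the arm collects the left factors in the nontrivial factorizations of the matrix
unit at `γ`. -/
theorem mem_rootArm_iff {γ α : Fin n × Fin n} : α ∈ rootArm γ ↔ α.1 = γ.1 ∧ α.2 ≠ γ.1 ∧
    α.2 ≠ γ.2 ∧ cyclicLength γ.1 α.2 + cyclicLength α.2 γ.2 = cyclicLength γ.1 γ.2 := by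
  rw [cyclicLength_add_iff]
  change _ ∧ _ ↔ _
  refine and_congr_right fun _ => ?_
  omega

end CyclicLength

/-! ### Rook matrices and their uniqueness in orbits -/

section RookMatrix

variable {ι R : Type*} [Zero R]

/-- A matrix with at most one nonzero entry in any row and in any column. -/
structure IsRookMatrix (M : Matrix ι ι R) : Prop where
  row : ∀ i j k, M i j ≠ 0 → M i k ≠ 0 → j = k
  col : ∀ i j k, M i k ≠ 0 → M j k ≠ 0 → i = j

end RookMatrix

section Uniqueness

variable {n : ℕ} {K : Type*} [Field K]

/-- Two rook matrices in the same two-sided orbit coincide. -/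
theorem IsRookMatrix.eq_of_mul_eq {M M' a b : Matrix (Fin n) (Fin n) K}
    (hM : IsRookMatrix M) (hM' : IsRookMatrix M') (ha : ∀ i, a i i = 1) (hb : ∀ i, b i i = 1)
    (h : ∀ i j, (∑ k, if cyclicLength i k + cyclicLength k j = cyclicLength i j
        then a i k * M k j else 0) =
      ∑ k, if cyclicLength i k + cyclicLength k j = cyclicLength i j
        then M' i k * b k j else 0) : M = M' := by
  suffices H : ∀ L : ℕ, ∀ i j, cyclicLength i j = L → M i j = M' i j by
    ext i j; exact H _ i j rfl
  intro L
  induction L using Nat.strong_induction_on with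
  | _ L ih =>
  rintro i j rfl
  have hij := h i j
  by_cases h1 : M i j ≠ 0
  -- On the left only the nonzero entry of column `j` of `M` contributes. On the right the other
  -- terms involve shorter positions of row `i`, where `M'` agrees with `M` by induction and so
  -- vanishes next to `M i j`.
  · rw [Finset.sum_eq_single i, Finset.sum_eq_single j] at hij
    · simpa [ha, hb] using hij
    · intro k _ hk
      split_ifs with hl
      · have hlt : cyclicLength i k < cyclicLength i j := by
          refine lt_of_le_of_ne (by omega) fun e => hk (cyclicLength_right_inj e)
        have : M' i k = 0 := by
          rw [← ih _ hlt i k rfl]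
          by_contra hne
          exact hk (hM.row _ _ _ hne h1)
        rw [this, zero_mul]
      · rfl
    · simp
    · intro k _ hk
      have : M k j = 0 := by
        by_contra hne
        exact hk (hM.col _ _ _ hne h1)
      simp [this]
    · simp
  · by_cases h2 : M' i j ≠ 0
    · rw [Finset.sum_eq_single i, Finset.sum_eq_single j] at hij
      · simpa [ha, hb] using hij
      · intro k _ hk
        have : M' i k = 0 := by
          by_contra hne
          exact hk (hM'.row _ _ _ hne h2)
        simp [this]
      · simp
      · intro k _ hk
        split_ifs with hl
        · have hlt : cyclicLength k j < cyclicLength i j := by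
            refine lt_of_le_of_ne (by omega) fun e => hk (cyclicLength_left_inj e)
          have : M k j = 0 := by
            rw [ih _ hlt k j rfl]
            by_contra hne
            exact hk (hM'.col _ _ _ hne h2)
          rw [this, mul_zero]
        · rfl
      · simp
    · push Not at h1 h2
      rw [h1, h2]

/-- Two rook matrices defining linear forms in the same two-sided orbit coincide. -/
theorem IsRookMatrix.eq_of_dual_mul_eq {M M' a b : Matrix (Fin n) (Fin n) K}
    (hM : IsRookMatrix M) (hM' : IsRookMatrix M') (hd : ∀ i, M i i = 0) (hd' : ∀ i, M' i i = 0)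
    (ha : ∀ i, a i i = 1) (hb : ∀ i, b i i = 1)
    (h : ∀ k l, k ≠ l → (∑ j, if cyclicLength k l + cyclicLength l j = cyclicLength k j
        then M k j * b l j else 0) =
      ∑ i, if cyclicLength i k + cyclicLength k l = cyclicLength i l
        then M' i l * a i k else 0) : M = M' := by
  -- The sums for linear forms run over positions at least as long as `(k, l)`, so the induction
  -- descends from the longest positions.
  suffices H : ∀ L : ℕ, ∀ k l, n - cyclicLength k l = L → M k l = M' k l by
    ext i j; exact H _ i j rfl
  intro L
  induction L using Nat.strong_induction_on with
  | _ L ih =>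
  rintro k l rfl
  by_cases hkl : k = l
  · rw [hkl, hd, hd']
  have hij := h k l hkl
  by_cases h1 : M k l ≠ 0
  · rw [Finset.sum_eq_single l, Finset.sum_eq_single k] at hij
    · simpa [ha, hb] using hij
    · intro i _ hi
      split_ifs with hl
      · have hlt : cyclicLength k l < cyclicLength i l := by
          refine lt_of_le_of_ne (by omega) fun e => hi (cyclicLength_left_inj e).symm
        have : M' i l = 0 := by
          rw [← ih _ (by have := cyclicLength_lt i l; omega) i l rfl]
          by_contra hne
          exact hi (hM.col _ _ _ hne h1)
        rw [this, zero_mul]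
      · rfl
    · simp
    · intro j _ hj
      have : M k j = 0 := by
        by_contra hne
        exact hj (hM.row _ _ _ hne h1)
      simp [this]
    · simp
  · by_cases h2 : M' k l ≠ 0
    · rw [Finset.sum_eq_single l, Finset.sum_eq_single k] at hij
      · simpa [ha, hb] using hij
      · intro i _ hi
        have : M' i l = 0 := by
          by_contra hne
          exact hi (hM'.col _ _ _ hne h2)
        simp [this]
      · simp
      · intro j _ hj
        split_ifs with hl
        · have hlt : cyclicLength k l < cyclicLength k j := by
            refine lt_of_le_of_ne (by omega) fun e => hj (cyclicLength_right_inj e).symm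
          have : M k j = 0 := by
            rw [ih _ (by have := cyclicLength_lt k j; omega) k j rfl]
            by_contra hne
            exact hj (hM'.row _ _ _ hne h2)
          rw [this, zero_mul]
        · rfl
      · simp
    · push Not at h1 h2
      rw [h1, h2]

end Uniqueness

/-! ### Matrix units, nilpotency and character sums on the radical -/

namespace BorelContraction

variable {n : ℕ} {K : Type*} [Field K]

theorem toMatrix_mul_eq_sum (X Y : BorelContraction n K) (i j : Fin n) :
    toMatrix (X * Y) i j = ∑ k : Fin n,
      if cyclicLength i k + cyclicLength k j = cyclicLength i j then
        toMatrix X i k * toMatrix Y k j else 0 := by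
  simp only [toMatrix_mul_apply, cyclicLength_add_iff]

instance : IsScalarTower K (BorelContraction n K) (BorelContraction n K) where
  smul_assoc c X Y := by
    apply toMatrix.injective
    simp only [smul_eq_mul, map_smul, toMatrix_mul, Matrix.smul_mul, smul_add, map_add]

instance : SMulCommClass K (BorelContraction n K) (BorelContraction n K) where
  smul_comm c X Y := by
    apply toMatrix.injective
    simp only [smul_eq_mul, map_smul, toMatrix_mul, Matrix.mul_smul, smul_add, map_add]

/-- The basis element `E_ij` or `F_ij`. -/
def matrixUnit (i j : Fin n) : BorelContraction n K := toMatrix.symm (Matrix.single i j 1)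

theorem toMatrix_matrixUnit (i j : Fin n) :
    toMatrix (matrixUnit i j : BorelContraction n K) = Matrix.single i j 1 := rfl

theorem matrixUnit_mem_radical {i j : Fin n} (h : i ≠ j) :
    (matrixUnit i j : BorelContraction n K) ∈ radical n K := by
  intro k
  rw [toMatrix_matrixUnit, Matrix.single_apply, if_neg]
  rintro ⟨rfl, rfl⟩
  exact h rfl

theorem toMatrix_mul_matrixUnit (X : BorelContraction n K) (k l i j : Fin n) :
    toMatrix (X * matrixUnit k l) i j =
      if j = l ∧ cyclicLength i k + cyclicLength k l = cyclicLength i l then toMatrix X i k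
      else 0 := by
  rw [toMatrix_mul_eq_sum, Finset.sum_eq_single k]
  · by_cases h : j = l
    · subst h; simp [toMatrix_matrixUnit]
    · simp [toMatrix_matrixUnit, h, Ne.symm h]
  · intro m _ hm
    simp [toMatrix_matrixUnit, Ne.symm hm]
  · simp

theorem toMatrix_matrixUnit_mul (X : BorelContraction n K) (k l i j : Fin n) :
    toMatrix (matrixUnit k l * X) i j =
      if i = k ∧ cyclicLength k l + cyclicLength l j = cyclicLength k j then toMatrix X l j
      else 0 := by
  rw [toMatrix_mul_eq_sum, Finset.sum_eq_single l]
  · by_cases h : i = k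
    · subst h; simp [toMatrix_matrixUnit]
    · simp [toMatrix_matrixUnit, h, Ne.symm h]
  · intro m _ hm
    simp [toMatrix_matrixUnit, Ne.symm hm]
  · simp

theorem mul_radical_mem (X Y : BorelContraction n K) (hY : Y ∈ radical n K) :
    X * Y ∈ radical n K := by
  intro i
  rw [toMatrix_mul_eq_sum]
  refine Finset.sum_eq_zero fun k _ => ?_
  split_ifs with h
  · obtain rfl : i = k := cyclicLength_eq_zero (by simp at h; omega)
    rw [hY i, mul_zero]
  · rfl

/-- Lengths add along a nonzero product, and each factor from the radical contributes at least one.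
-/
theorem pow_apply_eq_zero {X : BorelContraction n K} (hX : X ∈ radical n K) (m : ℕ) :
    ∀ i j, cyclicLength i j < m → toMatrix (X ^ m) i j = 0 := by
  induction m with
  | zero => intro i j h; omega
  | succ m ih =>
    intro i j h
    rw [pow_succ, toMatrix_mul_eq_sum]
    refine Finset.sum_eq_zero fun k _ => ?_
    split_ifs with hk
    · by_cases hkj : k = j
      · rw [hkj, hX j, mul_zero]
      · have : cyclicLength k j ≠ 0 := fun e => hkj (cyclicLength_eq_zero e)
        rw [ih i k (by omega), zero_mul]
    · rfl

theorem isNilpotent_of_mem_radical {X : BorelContraction n K} (hX : X ∈ radical n K) :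
    IsNilpotent X :=
  ⟨n, toMatrix.injective (by
    ext i j
    rw [pow_apply_eq_zero hX n i j (cyclicLength_lt i j)]
    simp)⟩

/-- The bijection `1 + X ↦ X` from the group to the radical. -/
noncomputable def nilPartEquiv : unipotentGroup n K ≃ radical n K where
  toFun u := ⟨nilPart u, nilPart_mem u⟩
  invFun X := ⟨(isNilpotent_of_mem_radical X.2).isUnit_one_add.unit, by
    change _ - 1 ∈ radical n K
    simp⟩
  left_inv u := by
    apply Subtype.ext
    apply Units.ext
    simp [nilPart]
  right_inv X := by
    apply Subtype.ext
    simp [nilPart]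

theorem nilPart_nilPartEquiv_symm (X : radical n K) : nilPart (nilPartEquiv.symm X) = X :=
  congrArg Subtype.val (nilPartEquiv.apply_symm_apply X)

theorem val_eq_one_add (u : unipotentGroup n K) :
    ((u : (BorelContraction n K)ˣ) : BorelContraction n K) = 1 + nilPart u := by
  simp [nilPart]

theorem toMatrix_val_apply_self (u : unipotentGroup n K) (i : Fin n) :
    toMatrix ((u : (BorelContraction n K)ˣ) : BorelContraction n K) i i = 1 := by
  rw [val_eq_one_add, map_add, Matrix.add_apply, nilPart_mem u i, toMatrix_one]
  simp

theorem nilPart_conj (x g : unipotentGroup n K) :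
    nilPart (x * g * x⁻¹) = (x : (BorelContraction n K)ˣ) * nilPart g *
      ((x⁻¹ : unipotentGroup n K) : (BorelContraction n K)ˣ) := by
  simp [nilPart, mul_sub, sub_mul]

/-- A nonzero linear form on the radical gives a nontrivial character sum. -/
theorem sum_addChar_eq_zero [Finite K] {ε : AddChar K ℂ} (hε : ε ≠ 1)
    (f : BorelContraction n K →ₗ[K] K) (hf : ∃ X ∈ radical n K, f X ≠ 0) :
    ∑ u : unipotentGroup n K, ε (f (nilPart u)) = 0 := by
  obtain ⟨X, hX, hfX⟩ := hf
  have := Fintype.ofFinite (radical n K)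
  have h1 : ∑ u : unipotentGroup n K, ε (f (nilPart u)) =
      ∑ Y : radical n K, ε.compAddMonoidHom
        (f.comp (radical n K).subtype).toAddMonoidHom Y :=
    Fintype.sum_equiv nilPartEquiv _ _ fun u => rfl
  rw [h1]
  refine AddChar.sum_eq_zero_of_ne_one fun h => hε ?_
  ext t
  -- The multiple of `X` at which `f` takes the value `t`.
  have h2 := DFunLike.congr_fun h ((t * (f X)⁻¹) • ⟨X, hX⟩)
  simpa [hfX] using h2

end BorelContraction

/-! ### Characters induced from linear characters -/

section InducedCharacter

open Representation

variable {G : Type*} [Group G] {H : Subgroup G} (ξ : H →* ℂ)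

/-- The one dimensional representation on `ℂ` given by a linear character. -/
noncomputable abbrev lineRep : Representation ℂ H ℂ :=
  (Algebra.lmul ℂ ℂ : ℂ →* Module.End ℂ ℂ).comp ξ

open Classical in
/-- Extension by zero of a function on a subgroup. -/
noncomputable def extendZero (g : G) : ℂ := if h : g ∈ H then ξ ⟨g, h⟩ else 0

theorem extendZero_mul_right (h : H) (g : G) : extendZero ξ (g * h) = extendZero ξ g * ξ h := by
  unfold extendZero
  by_cases hg : g ∈ H
  · rw [dif_pos (H.mul_mem hg h.2), dif_pos hg, ← map_mul]
    rfl
  · rw [dif_neg hg, dif_neg (by rwa [H.mul_mem_cancel_right h.2]), zero_mul]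

/-- The class of `g ⊗ 1` in the induced representation. -/
noncomputable def indVec (g : G) : IndV H.subtype (lineRep ξ) :=
  IndV.mk H.subtype (lineRep ξ) g 1

theorem ind_indVec (g x : G) :
    ind H.subtype (lineRep ξ) g (indVec ξ x) = indVec ξ (x * g⁻¹) :=
  ind_mk _ _ _ _ _

/-- In the coinvariants, `g ⊗ 1` is identified with its translate `hg ⊗ ξ(h)`. -/
theorem smul_indVec_mul (h : H) (g : G) :
    ξ h • indVec ξ (h * g) = indVec ξ g := by
  rw [indVec, indVec, ← map_smul]
  have := Coinvariants.mk_self_apply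
    (ρ := Representation.tprod ((leftRegular ℂ G).comp H.subtype) (lineRep ξ)) h
    (TensorProduct.tmul ℂ (.single g 1) (1 : ℂ))
  simpa using this

/-- The embedding of the induced representation into the functions on the group. -/
noncomputable def indToFun : IndV H.subtype (lineRep ξ) →ₗ[ℂ] (G → ℂ) :=
  Coinvariants.lift _ (TensorProduct.lift
    ((Finsupp.linearCombination ℂ fun g => LinearMap.toSpanSingleton ℂ (G → ℂ)
        (fun y => extendZero ξ (y * g⁻¹))) ∘ₗ
      (MonoidAlgebra.coeffLinearEquiv ℂ).toLinearMap)) fun h => by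
    ext g y
    have h1 : extendZero ξ (y * (g⁻¹ * (h : G)⁻¹)) = extendZero ξ (y * g⁻¹) * ξ h⁻¹ := by
      rw [← mul_assoc, ← extendZero_mul_right]
      rfl
    -- Invariance under `h`: the factor from the action on `ℂ` cancels the one from translating the
    -- function.
    have h2 : ξ h * ξ h⁻¹ = 1 := by rw [← map_mul, mul_inv_cancel, map_one]
    simp only [TensorProduct.AlgebraTensorModule.curry_apply, LinearMap.comp_apply]
    simpa [h1, mul_left_comm (ξ h)] using
      congrArg (extendZero ξ (y * g⁻¹) * ·) h2

theorem indToFun_indVec (g y : G) :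
    indToFun ξ (indVec ξ g) y = extendZero ξ (y * g⁻¹) := by
  simp [indToFun, indVec]

theorem nontrivial_indV : Nontrivial (IndV H.subtype (lineRep ξ)) := by
  refine ⟨indVec ξ 1, 0, fun h => ?_⟩
  have h1 := congrFun (congrArg (indToFun ξ) h) 1
  rw [indToFun_indVec] at h1
  have h2 : extendZero ξ (1 : G) = 1 := by
    rw [extendZero, dif_pos H.one_mem]
    exact map_one ξ
  simp [h2] at h1

variable [Fintype G]

/-- The averaging map from the functions on the group onto the induced representation. -/
noncomputable def funToInd : (G → ℂ) →ₗ[ℂ] IndV H.subtype (lineRep ξ) :=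
  (Nat.card H : ℂ)⁻¹ • ∑ x : G, (LinearMap.toSpanSingleton ℂ _ (indVec ξ x)) ∘ₗ
    LinearMap.proj x

/-- The function attached to `g` is supported on the coset `Hg`, and each of its `|H|` points
contributes the class of `g` itself. The induced representation is therefore a retract of the
functions on `G`, which yields both its finite dimension and its traces. -/
theorem funToInd_comp_indToFun : funToInd ξ ∘ₗ indToFun ξ = LinearMap.id := by
  classical
  have := Fintype.ofFinite H
  apply IndV.hom_ext
  intro g
  ext
  have h0 : (Nat.card H : ℂ) ≠ 0 := by simp
  have key : ∑ x : G, indToFun ξ (indVec ξ g) x •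
      indVec ξ x =
      (Nat.card H : ℂ) • indVec ξ g := by
    simp only [indToFun_indVec]
    rw [← Equiv.sum_comp (Equiv.mulRight g)]
    simp only [Equiv.coe_mulRight, mul_inv_cancel_right]
    have h1 : ∀ x : G, extendZero ξ x • indVec ξ (x * g) =
        if x ∈ H then indVec ξ g else 0 := by
      intro x
      unfold extendZero
      split_ifs with hx
      · exact smul_indVec_mul ξ ⟨x, hx⟩ g
      · rw [zero_smul]
    rw [Finset.sum_congr rfl fun x _ => h1 x, ← Finset.sum_filter, Finset.sum_const,
      Nat.cast_smul_eq_nsmul]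
    congr 1
    rw [Nat.card_eq_fintype_card, Fintype.card_subtype]
  change funToInd ξ (indToFun ξ (indVec ξ g)) =
    indVec ξ g
  rw [funToInd, LinearMap.smul_apply, LinearMap.sum_apply]
  simp only [LinearMap.comp_apply, LinearMap.proj_apply, LinearMap.toSpanSingleton_apply]
  rw [key, smul_smul, inv_mul_cancel₀ h0, one_smul]

theorem finite_indV : Module.Finite ℂ (IndV H.subtype (lineRep ξ)) :=
  Module.Finite.of_surjective (funToInd ξ) fun v =>
    ⟨indToFun ξ v, LinearMap.congr_fun (funToInd_comp_indToFun ξ) v⟩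

theorem funToInd_single [DecidableEq G] (x : G) : funToInd ξ (Pi.single x 1) =
    (Nat.card H : ℂ)⁻¹ • indVec ξ x := by
  rw [funToInd, LinearMap.smul_apply, LinearMap.sum_apply, Finset.sum_eq_single x]
  · simp only [LinearMap.comp_apply, LinearMap.proj_apply, LinearMap.toSpanSingleton_apply,
      Pi.single_eq_same, one_smul]
  · intro y _ hy
    simp only [LinearMap.comp_apply, LinearMap.proj_apply, LinearMap.toSpanSingleton_apply,
      Pi.single_eq_of_ne hy, zero_smul]
  · simp

/-- The Frobenius formula for the character induced from a linear character. -/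
theorem character_ind (g : G) : (ind H.subtype (lineRep ξ)).character g =
    (Nat.card H : ℂ)⁻¹ * ∑ x : G, extendZero ξ (x * g * x⁻¹) := by
  classical
  have := finite_indV ξ
  have h1 : ind H.subtype (lineRep ξ) g =
      (ind H.subtype (lineRep ξ) g ∘ₗ funToInd ξ) ∘ₗ indToFun ξ := by
    rw [LinearMap.comp_assoc, funToInd_comp_indToFun, LinearMap.comp_id]
  -- By cyclicity the trace is computed on the functions on `G`, where the basis of delta functions
  -- gives one diagonal entry for each `x`.
  rw [Representation.character, h1, LinearMap.trace_comp_comm',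
    LinearMap.trace_eq_matrix_trace ℂ (Pi.basisFun ℂ G), Matrix.trace, Finset.mul_sum]
  refine Finset.sum_congr rfl fun x _ => ?_
  rw [Matrix.diag_apply, LinearMap.toMatrix_apply]
  simp only [Pi.basisFun_apply, LinearMap.comp_apply, funToInd_single,
    map_smul]
  rw [ind_indVec]
  simp [indToFun_indVec, mul_assoc]

theorem isComplexCharacter_ind :
    IsComplexCharacter (ind H.subtype (lineRep ξ)).character := by
  have := finite_indV ξ
  have := nontrivial_indV ξ
  let e := (Module.finBasis ℂ (IndV H.subtype (lineRep ξ))).equivFun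
  refine ⟨_, Module.finrank_pos (R := ℂ) (M := IndV H.subtype (lineRep ξ)),
    (e.conjRingEquiv : _ →* _).comp (ind H.subtype (lineRep ξ)), ?_⟩
  funext g
  exact LinearMap.trace_conj' _ e

end InducedCharacter

/-! ### Reduction to rook form within an orbit -/

namespace BorelContraction

variable {n : ℕ} {K : Type*} [Field K]

/-- `Y` lies in the two-sided orbit `U^a X U^a`. -/
def InOrbit (X Y : BorelContraction n K) : Prop :=
  ∃ a b : unipotentGroup n K, Y = (a : (BorelContraction n K)ˣ) * X * (b : (BorelContraction n K)ˣ)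

theorem InOrbit.refl (X : BorelContraction n K) : InOrbit X X := ⟨1, 1, by simp⟩

theorem InOrbit.trans {X Y Z : BorelContraction n K} (h : InOrbit X Y) (h' : InOrbit Y Z) :
    InOrbit X Z := by
  obtain ⟨a, b, rfl⟩ := h
  obtain ⟨c, d, rfl⟩ := h'
  exact ⟨c * a, b * d, by simp [mul_assoc]⟩

theorem InOrbit.symm {X Y : BorelContraction n K} (h : InOrbit X Y) : InOrbit Y X := by
  obtain ⟨a, b, rfl⟩ := h
  exact ⟨a⁻¹, b⁻¹, by simp [mul_assoc]⟩

theorem InOrbit.mem_radical {X Y : BorelContraction n K} (h : InOrbit X Y)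
    (hX : X ∈ radical n K) : Y ∈ radical n K := by
  obtain ⟨a, b, rfl⟩ := h
  exact radical_mul_mem _ _ (mul_radical_mem _ _ hX)

theorem inOrbit_mul_right (X : BorelContraction n K) {N : BorelContraction n K}
    (hN : N ∈ radical n K) : InOrbit X (X + X * N) := by
  refine ⟨1, nilPartEquiv.symm ⟨N, hN⟩, ?_⟩
  rw [val_eq_one_add (nilPartEquiv.symm _), nilPart_nilPartEquiv_symm]
  simp [mul_add]

theorem inOrbit_mul_left (X : BorelContraction n K) {N : BorelContraction n K}
    (hN : N ∈ radical n K) : InOrbit X (X + N * X) := by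
  refine ⟨nilPartEquiv.symm ⟨N, hN⟩, 1, ?_⟩
  rw [val_eq_one_add (nilPartEquiv.symm _), nilPart_nilPartEquiv_symm]
  simp [add_mul]

/-- A linear order on the positions of a matrix in which longer positions are smaller. -/
def positionKey (p : Fin n × Fin n) : ℕᵒᵈ ×ₗ Fin n :=
  toLex (OrderDual.toDual (cyclicLength p.1 p.2), p.1)

theorem positionKey_injective : Function.Injective (positionKey (n := n)) := by
  rintro ⟨i, j⟩ ⟨k, l⟩ h
  have h1 := congrArg ofLex h
  simp only [positionKey, ofLex_toLex, Prod.mk.injEq, OrderDual.toDual_inj] at h1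
  obtain ⟨h1, rfl⟩ := h1
  rw [cyclicLength_right_inj h1]

theorem positionKey_lt {p q : Fin n × Fin n}
    (h : cyclicLength q.1 q.2 < cyclicLength p.1 p.2) : positionKey p < positionKey q :=
  Prod.Lex.toLex_lt_toLex.mpr (Or.inl h)

open Classical in
/-- The set of nonzero positions, as an element of a colexicographically ordered set. -/
noncomputable def supportKey (X : BorelContraction n K) : Colex (Finset (ℕᵒᵈ ×ₗ Fin n)) :=
  toColex ((Finset.univ.filter fun p : Fin n × Fin n => toMatrix X p.1 p.2 ≠ 0).image positionKey)

/-- Colexicographic comparison is decided by the largest key. Losing `p` outweighs any gained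
positions, since these are longer and hence have smaller keys. -/
theorem supportKey_lt {X Y : BorelContraction n K} (p : Fin n × Fin n)
    (hX : toMatrix X p.1 p.2 ≠ 0) (hY : toMatrix Y p.1 p.2 = 0)
    (h : ∀ i j, toMatrix X i j = 0 → toMatrix Y i j ≠ 0 →
      cyclicLength p.1 p.2 < cyclicLength i j) : supportKey Y < supportKey X := by
  have hmem : ∀ (Z : BorelContraction n K) (q : Fin n × Fin n),
      positionKey q ∈ ofColex (supportKey Z) ↔ toMatrix Z q.1 q.2 ≠ 0 := by
    intro Z q
    simp [supportKey, positionKey_injective.eq_iff]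
  rw [Finset.Colex.lt_iff_exists_forall_lt]
  refine ⟨positionKey p, (hmem X p).mpr hX, fun hp => (hmem Y p).mp hp hY, ?_⟩
  intro b hb hb'
  obtain ⟨q, -, rfl⟩ := Finset.mem_image.mp hb
  exact positionKey_lt (h _ _ (not_not.mp (mt (hmem X q).mpr hb')) ((hmem Y q).mp hb))

/-- A nonzero position with a longer nonzero position in its row or in its column. -/
def IsConflict (X : BorelContraction n K) (k j : Fin n) : Prop :=
  toMatrix X k j ≠ 0 ∧
    ((∃ l, cyclicLength k j < cyclicLength k l ∧ toMatrix X k l ≠ 0) ∨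
      ∃ l, cyclicLength k j < cyclicLength l j ∧ toMatrix X l j ≠ 0)

/-- Distinct positions in one row or column have distinct lengths, so of two nonzero ones the
shorter is a conflict. -/
theorem isRookMatrix_of_forall_not_isConflict {X : BorelContraction n K}
    (h : ∀ k j, ¬ IsConflict X k j) : IsRookMatrix (toMatrix X) where
  row i j k hj hk := by
    rcases lt_trichotomy (cyclicLength i j) (cyclicLength i k) with hl | hl | hl
    · exact absurd ⟨hj, Or.inl ⟨k, hl, hk⟩⟩ (h i j)
    · exact cyclicLength_right_inj hl
    · exact absurd ⟨hk, Or.inl ⟨j, hl, hj⟩⟩ (h i k)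
  col i j k hi hj := by
    rcases lt_trichotomy (cyclicLength i k) (cyclicLength j k) with hl | hl | hl
    · exact absurd ⟨hi, Or.inr ⟨j, hl, hj⟩⟩ (h i k)
    · exact cyclicLength_left_inj hl
    · exact absurd ⟨hj, Or.inr ⟨i, hl, hi⟩⟩ (h j k)

/-- An element with a conflict can be moved in its orbit to one with a smaller support. -/
theorem exists_supportKey_lt {X : BorelContraction n K} (h : ∃ k j, IsConflict X k j) :
    ∃ Y, InOrbit X Y ∧ supportKey Y < supportKey X := by
  classical
  have h' : ∃ L, ∃ k j, cyclicLength k j = L ∧ IsConflict X k j := by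
    obtain ⟨k, j, h⟩ := h
    exact ⟨_, k, j, rfl, h⟩
  -- A shortest conflict is used as pivot, which controls the entries created by clearing.
  obtain ⟨k, j, hL, hkj, hc⟩ := Nat.find_spec h'
  have hmin : ∀ i m, cyclicLength i m < cyclicLength k j → ¬ IsConflict X i m := by
    intro i m hlt hcon
    rw [hL] at hlt
    exact Nat.find_min h' hlt ⟨i, m, rfl, hcon⟩
  rcases hc with ⟨l, hlt, hl⟩ | ⟨l, hlt, hl⟩
  · have hjl : j ≠ l := by rintro rfl; exact lt_irrefl _ hlt
    -- Adding `c` times column `j` to column `l` clears the longer entry `(k, l)`.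
    set c := -(toMatrix X k l / toMatrix X k j) with hcdef
    have hY : ∀ a b, toMatrix (X + X * (c • matrixUnit j l)) a b = toMatrix X a b + c *
        if b = l ∧ cyclicLength a j + cyclicLength j l = cyclicLength a l then toMatrix X a j
        else 0 := by
      intro a b
      rw [mul_smul_comm, map_add, map_smul, Matrix.add_apply, Matrix.smul_apply,
        toMatrix_mul_matrixUnit, smul_eq_mul]
    have hadd := cyclicLength_add_of_le_left hlt.le
    refine ⟨_, inOrbit_mul_right X (Submodule.smul_mem _ c (matrixUnit_mem_radical hjl)),
      supportKey_lt (k, l) hl ?_ ?_⟩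
    · rw [hY, if_pos ⟨rfl, hadd⟩, hcdef]
      field_simp
      simp
    -- A new entry in row `a` of column `l` comes from a nonzero `(a, j)`. If `(a, j)` were shorter
    -- than `(k, j)` it would be a shorter conflict; equal length would force `a = k`. So it is
    -- longer, and therefore the new entry is longer than `(k, l)`.
    · intro a b h1 h2
      rw [hY, h1, zero_add] at h2
      split_ifs at h2 with hab
      · obtain ⟨rfl, hab⟩ := hab
        have haj := right_ne_zero_of_mul h2
        have hne : cyclicLength a j ≠ cyclicLength k j := by
          intro e
          rw [cyclicLength_left_inj e] at h1
          exact hl h1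
        have hge : ¬ cyclicLength a j < cyclicLength k j := fun e =>
          hmin a j e ⟨haj, Or.inr ⟨k, e, hkj⟩⟩
        change cyclicLength k b < cyclicLength a b
        omega
      · simp at h2
  · have hlk : l ≠ k := by rintro rfl; exact lt_irrefl _ hlt
    -- The mirror image: a multiple of row `k` clears the longer entry of column `j` in row `l`.
    set c := -(toMatrix X l j / toMatrix X k j) with hcdef
    have hY : ∀ a b, toMatrix (X + (c • matrixUnit l k) * X) a b = toMatrix X a b + c *
        if a = l ∧ cyclicLength l k + cyclicLength k b = cyclicLength l b then toMatrix X k b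
        else 0 := by
      intro a b
      rw [smul_mul_assoc, map_add, map_smul, Matrix.add_apply, Matrix.smul_apply,
        toMatrix_matrixUnit_mul, smul_eq_mul]
    have hadd := cyclicLength_add_of_le_right hlt.le
    refine ⟨_, inOrbit_mul_left X (Submodule.smul_mem _ c (matrixUnit_mem_radical hlk)),
      supportKey_lt (l, j) hl ?_ ?_⟩
    · rw [hY, if_pos ⟨rfl, hadd⟩, hcdef]
      field_simp
      simp
    · intro a b h1 h2
      rw [hY, h1, zero_add] at h2
      split_ifs at h2 with hab
      · obtain ⟨rfl, hab⟩ := hab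
        have hkb := right_ne_zero_of_mul h2
        have hne : cyclicLength k b ≠ cyclicLength k j := by
          intro e
          rw [cyclicLength_right_inj e] at h1
          exact hl h1
        have hge : ¬ cyclicLength k b < cyclicLength k j := fun e =>
          hmin k b e ⟨hkb, Or.inl ⟨j, e, hkj⟩⟩
        change cyclicLength a j < cyclicLength a b
        omega
      · simp at h2

theorem exists_inOrbit_isRookMatrix [Finite K] (X : BorelContraction n K) :
    ∃ Y, InOrbit X Y ∧ IsRookMatrix (toMatrix Y) := by
  obtain ⟨Y, hY, hmin⟩ := Set.exists_min_image {Y | InOrbit X Y} supportKey (Set.toFinite _)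
    ⟨X, InOrbit.refl X⟩
  refine ⟨Y, hY, isRookMatrix_of_forall_not_isConflict fun k j hc => ?_⟩
  obtain ⟨Z, hZ, hlt⟩ := exists_supportKey_lt ⟨k, j, hc⟩
  exact absurd (hmin Z (hY.trans hZ)) (not_le.mpr hlt)

end BorelContraction

/-! ### The partition into superclasses -/

namespace RookDatum

open BorelContraction

variable {n : ℕ} {K : Type*} [Field K]

theorem toMatrix_element (d : RookDatum n K) (i j : Fin n) :
    toMatrix d.element i j = if h : (i, j) ∈ d.D.roots then (d.φ ⟨(i, j), h⟩ : K) else 0 := by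
  rw [element, map_sum, Matrix.sum_apply]
  split_ifs with h
  · rw [Finset.sum_eq_single ⟨(i, j), h⟩]
    · simp
    · rintro ⟨⟨a, b⟩, hab⟩ - hne
      rw [LinearEquiv.apply_symm_apply, Matrix.single_apply, if_neg]
      rintro ⟨rfl, rfl⟩
      exact hne rfl
    · simp
  · refine Finset.sum_eq_zero ?_
    rintro ⟨⟨a, b⟩, hab⟩ -
    rw [LinearEquiv.apply_symm_apply, Matrix.single_apply, if_neg]
    rintro ⟨rfl, rfl⟩
    exact h hab

theorem toMatrix_element_ne_zero (d : RookDatum n K) (i j : Fin n) :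
    toMatrix d.element i j ≠ 0 ↔ (i, j) ∈ d.D.roots := by
  rw [toMatrix_element]
  split_ifs with h <;> simp [h]

theorem isRookMatrix (d : RookDatum n K) : IsRookMatrix (toMatrix d.element) where
  row i j k hj hk := by
    rw [toMatrix_element_ne_zero] at hj hk
    exact congrArg Prod.snd (d.D.row_inj _ hj _ hk rfl)
  col i j k hi hj := by
    rw [toMatrix_element_ne_zero] at hi hj
    exact congrArg Prod.fst (d.D.col_inj _ hi _ hj rfl)

theorem element_mem_radical (d : RookDatum n K) : d.element ∈ radical n K := by
  intro i
  by_contra h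
  exact d.D.ne _ ((d.toMatrix_element_ne_zero i i).mp h) rfl

theorem element_injective : Function.Injective (element (n := n) (K := K)) := by
  intro d d' h
  have hroots : d.D.roots = d'.D.roots := by
    ext ⟨i, j⟩
    rw [← toMatrix_element_ne_zero, h, toMatrix_element_ne_zero]
  obtain ⟨⟨D, _, _, _⟩, φ⟩ := d
  obtain ⟨⟨D', _, _, _⟩, φ'⟩ := d'
  obtain rfl : D = D' := hroots
  congr 1
  ext ⟨⟨i, j⟩, hij⟩
  have h1 := congrFun (congrFun (congrArg toMatrix h) i) j
  rw [toMatrix_element, toMatrix_element, dif_pos hij, dif_pos hij] at h1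
  exact h1

theorem exists_element_eq {X : BorelContraction n K} (hX : X ∈ radical n K)
    (h : IsRookMatrix (toMatrix X)) : ∃ d : RookDatum n K, d.element = X := by
  classical
  let D : RookPlacement n := ⟨Finset.univ.filter fun p => toMatrix X p.1 p.2 ≠ 0, ?_, ?_, ?_⟩
  · refine ⟨⟨D, fun γ => Units.mk0 (toMatrix X γ.1.1 γ.1.2) (Finset.mem_filter.mp γ.2).2⟩, ?_⟩
    apply toMatrix.injective
    ext i j
    rw [toMatrix_element]
    by_cases hij : toMatrix X i j = 0 <;> simp [D, hij]
  · rintro ⟨i, j⟩ hij (rfl : i = j)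
    simp [hX i] at hij
  · rintro ⟨i, j⟩ hij ⟨k, l⟩ hkl (rfl : i = k)
    simp only [Finset.mem_filter, Finset.mem_univ, true_and] at hij hkl
    rw [h.row _ _ _ hij hkl]
  · rintro ⟨i, j⟩ hij ⟨k, l⟩ hkl (rfl : j = l)
    simp only [Finset.mem_filter, Finset.mem_univ, true_and] at hij hkl
    rw [h.col _ _ _ hij hkl]

theorem eq_of_inOrbit {d d' : RookDatum n K} (h : InOrbit d.element d'.element) : d = d' := by
  obtain ⟨a, b, h⟩ := h
  apply element_injective
  apply toMatrix.injective
  -- The relation `X' = a X b` is used in the form `a X = X' b⁻¹`.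
  refine d.isRookMatrix.eq_of_mul_eq d'.isRookMatrix (toMatrix_val_apply_self a)
    (toMatrix_val_apply_self b⁻¹) fun i j => ?_
  rw [← toMatrix_mul_eq_sum, ← toMatrix_mul_eq_sum, h]
  simp [mul_assoc]

theorem mem_superclass_iff {d : RookDatum n K} {g : unipotentGroup n K} :
    g ∈ d.superclass ↔ InOrbit d.element (nilPart g) := Iff.rfl

theorem superclass_nonempty (d : RookDatum n K) : d.superclass.Nonempty :=
  ⟨nilPartEquiv.symm ⟨d.element, d.element_mem_radical⟩, by
    rw [mem_superclass_iff, nilPart_nilPartEquiv_symm]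
    exact InOrbit.refl _⟩

theorem disjoint_superclass {d d' : RookDatum n K} (h : d ≠ d') :
    Disjoint d.superclass d'.superclass :=
  Set.disjoint_left.mpr fun _ hg hg' => h (eq_of_inOrbit (InOrbit.trans hg (InOrbit.symm hg')))

theorem iUnion_superclass [Finite K] : ⋃ d : RookDatum n K, d.superclass = Set.univ := by
  refine Set.eq_univ_of_forall fun g => Set.mem_iUnion.mpr ?_
  obtain ⟨Y, hY, hrook⟩ := exists_inOrbit_isRookMatrix (nilPart g)
  obtain ⟨d, rfl⟩ := exists_element_eq (hY.mem_radical (nilPart_mem g)) hrook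
  exact ⟨d, hY.symm⟩

theorem exists_superclass_eq_one : ∃ d : RookDatum n K, d.superclass = {1} := by
  obtain ⟨d, hd⟩ := exists_element_eq (zero_mem (radical n K))
    ⟨fun i j k h => absurd (by simp) h, fun i j k h => absurd (by simp) h⟩
  refine ⟨d, Set.ext fun g => ?_⟩
  have h1 : nilPart g = 0 ↔ g = 1 := by
    rw [nilPart, sub_eq_zero, ← Units.val_one, Units.val_inj, OneMemClass.coe_eq_one]
  rw [mem_superclass_iff, hd, Set.mem_singleton_iff, ← h1]
  constructor
  · rintro ⟨a, b, h⟩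
    simpa using h
  · intro h
    rw [h]
    exact InOrbit.refl _

end RookDatum

/-! ### Linear forms, character values and orthogonality -/

namespace RookDatum

open BorelContraction

variable {n : ℕ} {K : Type*} [Field K]

theorem toMatrix_element_transpose (d : RookDatum n K) (i j : Fin n) :
    toMatrix d.transpose.element i j = toMatrix d.element j i := by
  rw [toMatrix_element, toMatrix_element]
  have h : (i, j) ∈ d.transpose.D.roots ↔ (j, i) ∈ d.D.roots :=
    ⟨d.D.swap_mem, fun h => Finset.mem_map.mpr ⟨_, h, rfl⟩⟩
  by_cases hij : (j, i) ∈ d.D.roots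
  · rw [dif_pos hij, dif_pos (h.mpr hij)]
    rfl
  · rw [dif_neg hij, dif_neg (mt h.mp hij)]

/-- The transposition in the definition of `Λ` cancels the one in the bilinear form, leaving the
entrywise pairing with the element itself. -/
theorem functional_eq_sum (d : RookDatum n K) (Y : BorelContraction n K) :
    d.functional Y = ∑ i, ∑ j, toMatrix d.element i j * toMatrix Y i j := by
  rw [functional, form_eq_sum, Finset.sum_comm]
  refine Finset.sum_congr rfl fun i _ => Finset.sum_congr rfl fun j _ => ?_
  rw [toMatrix_element_transpose]
  split_ifs with h
  · rfl
  · obtain rfl : j = i := not_not.mp h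
    rw [d.element_mem_radical, zero_mul]

/-- The linear form `Λ_{D,φ}` as a linear map. -/
def functionalLinear (d : RookDatum n K) : BorelContraction n K →ₗ[K] K where
  toFun := d.functional
  map_add' := d.functional_add
  map_smul' c Y := by
    simp only [functional_eq_sum, map_smul, Matrix.smul_apply, smul_eq_mul, Finset.mul_sum,
      RingHom.id_apply, mul_left_comm c]

theorem functionalLinear_apply (d : RookDatum n K) (Y : BorelContraction n K) :
    d.functionalLinear Y = d.functional Y := rfl

theorem functional_mul_matrixUnit (d : RookDatum n K) (X : BorelContraction n K) (k l : Fin n) :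
    d.functional (X * matrixUnit k l) = ∑ i,
      if cyclicLength i k + cyclicLength k l = cyclicLength i l
        then toMatrix d.element i l * toMatrix X i k else 0 := by
  rw [functional_eq_sum]
  refine Finset.sum_congr rfl fun i _ => ?_
  rw [Finset.sum_eq_single l]
  · simp [toMatrix_mul_matrixUnit]
  · intro j _ hj
    simp [toMatrix_mul_matrixUnit, hj]
  · simp

theorem functional_matrixUnit_mul (d : RookDatum n K) (X : BorelContraction n K) (k l : Fin n) :
    d.functional (matrixUnit k l * X) = ∑ j,
      if cyclicLength k l + cyclicLength l j = cyclicLength k j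
        then toMatrix d.element k j * toMatrix X l j else 0 := by
  rw [functional_eq_sum, Finset.sum_eq_single k]
  · simp [toMatrix_matrixUnit_mul]
  · intro i _ hi
    refine Finset.sum_eq_zero fun j _ => ?_
    simp [toMatrix_matrixUnit_mul, hi]
  · simp

/-- Data whose linear forms lie in the same two-sided orbit coincide. -/
theorem eq_of_functional_eq {d d' : RookDatum n K} (a b c e : unipotentGroup n K)
    (h : ∀ X ∈ radical n K,
      d.functional ((a : (BorelContraction n K)ˣ) * X * (b : (BorelContraction n K)ˣ)) =
      d'.functional ((c : (BorelContraction n K)ˣ) * X * (e : (BorelContraction n K)ˣ))) :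
    d = d' := by
  apply element_injective
  apply toMatrix.injective
  refine d.isRookMatrix.eq_of_dual_mul_eq d'.isRookMatrix d.element_mem_radical
    d'.element_mem_radical (toMatrix_val_apply_self (c * a⁻¹)) (toMatrix_val_apply_self (e⁻¹ * b))
    fun k l hkl => ?_
  rw [← functional_matrixUnit_mul, ← functional_mul_matrixUnit]
  -- At `a⁻¹ E e⁻¹`, with `E` the matrix unit, the hypothesis has one group element on each side:
  -- `e⁻¹ b` to the right of `E` and `c a⁻¹` to its left.
  have h1 := h (((a⁻¹ : unipotentGroup n K) : (BorelContraction n K)ˣ) *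
    (matrixUnit k l : BorelContraction n K) *
    ((e⁻¹ : unipotentGroup n K) : (BorelContraction n K)ˣ))
    (radical_mul_mem _ _ (mul_radical_mem _ _ (matrixUnit_mem_radical hkl)))
  simpa [mul_assoc] using h1

/-- An element annihilated by `Λ_{D,φ}(· Y)` for all `Y` lies in `𝔘_D`. -/
theorem exists_functional_mul_ne_zero (d : RookDatum n K) {X : BorelContraction n K}
    (hX : X ∈ radical n K) (h : X ∉ d.D.radicalSub K) :
    ∃ Y ∈ radical n K, d.functional (X * Y) ≠ 0 := by
  have h1 : ∃ γ ∈ d.D.roots, ∃ α ∈ rootArm γ, toMatrix X α.1 α.2 ≠ 0 := by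
    by_contra hcon
    push Not at hcon
    exact h ⟨hX, hcon⟩
  obtain ⟨⟨i, j⟩, hγ, ⟨a, k⟩, hα, hne⟩ := h1
  obtain ⟨rfl, -, hkj, hlen⟩ := mem_rootArm_iff.mp hα
  simp only at hkj hlen hne
  -- This unit completes `(a, k)` to the root `(a, j)`. The product lives in column `j`, where the
  -- rook element has no other nonzero entry, so nothing can cancel.
  refine ⟨matrixUnit k j, matrixUnit_mem_radical hkj, ?_⟩
  have hij := (d.toMatrix_element_ne_zero _ _).mpr hγ
  rw [functional_mul_matrixUnit, Finset.sum_eq_single a, if_pos hlen]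
  · exact mul_ne_zero hij hne
  · intro m _ hm
    have : toMatrix d.element m j = 0 := by
      by_contra hmj
      exact hm (d.isRookMatrix.col _ _ _ hmj hij)
    simp [this]
  · simp

variable [Finite K]

/-- With `g = 1 + X` and `u = 1 + Y`, the summand is `ε(Λ(X))` times `ε(Λ(X Y))`. The form `Y ↦ Λ(X
Y)` vanishes on the radical exactly when `g` lies in `U_D`; otherwise its character sum is zero. -/
theorem card_mul_extendZero {ε : AddChar K ℂ} (hε : ε ≠ 1) (d : RookDatum n K)
    (g : unipotentGroup n K) :
    (Nat.card (unipotentGroup n K) : ℂ) * extendZero (d.linearCharacter ε) g =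
      ∑ u : unipotentGroup n K,
        ε (d.functional (nilPart g * (u : (BorelContraction n K)ˣ))) := by
  have h1 : ∀ u : unipotentGroup n K,
      ε (d.functional (nilPart g * (u : (BorelContraction n K)ˣ))) =
        ε (d.functional (nilPart g)) * ε (d.functional (nilPart g * nilPart u)) := by
    intro u
    rw [val_eq_one_add, mul_add, mul_one, functional_add, AddChar.map_add_eq_mul]
  rw [Finset.sum_congr rfl fun u _ => h1 u, ← Finset.mul_sum, extendZero]
  split_ifs with hg
  · have h2 : ∀ u : unipotentGroup n K, ε (d.functional (nilPart g * nilPart u)) = 1 := by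
      intro u
      rw [d.functional_mul hg (nilPart_mem u), AddChar.map_zero_eq_one]
    simp only [h2, Finset.sum_const, nsmul_eq_mul, mul_one, Finset.card_univ,
      Nat.card_eq_fintype_card, mul_comm]
    rfl
  · rw [mul_zero]
    have h2 := sum_addChar_eq_zero hε
      (d.functionalLinear ∘ₗ LinearMap.mulLeft K (nilPart g))
      (d.exists_functional_mul_ne_zero (nilPart_mem g) hg)
    simp only [LinearMap.comp_apply, LinearMap.mulLeft_apply, functionalLinear_apply] at h2
    rw [h2, mul_zero]

/-- The values of `χ_{D,φ}` as a sum over pairs of group elements. -/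
theorem character_eq_sum {ε : AddChar K ℂ} (hε : ε ≠ 1) (d : RookDatum n K)
    (g : unipotentGroup n K) :
    d.character ε g = (Nat.card (d.D.subgroup K) : ℂ)⁻¹ *
      ((Nat.card (unipotentGroup n K) : ℂ)⁻¹ *
        ∑ x : unipotentGroup n K, ∑ y : unipotentGroup n K,
          ε (d.functional ((x : (BorelContraction n K)ˣ) * nilPart g *
            (y : (BorelContraction n K)ˣ)))) := by
  have h0 : (Nat.card (unipotentGroup n K) : ℂ) ≠ 0 := by simp
  rw [character, character_ind]
  congr 1
  rw [eq_inv_mul_iff_mul_eq₀ h0, Finset.mul_sum]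
  refine Finset.sum_congr rfl fun x _ => ?_
  -- Replacing `y` by `x y` absorbs the right factor `x⁻¹` of the conjugation, so that `x` and `y`
  -- vary independently.
  rw [card_mul_extendZero hε, ← Equiv.sum_comp (Equiv.mulLeft x)]
  refine Finset.sum_congr rfl fun y _ => ?_
  rw [nilPart_conj]
  simp [mul_assoc]

theorem isComplexCharacter_character (ε : AddChar K ℂ) (d : RookDatum n K) :
    IsComplexCharacter (d.character ε) :=
  isComplexCharacter_ind _

/-- Moving within the orbit only translates the summation variables `x` and `y` in
`character_eq_sum`. -/
theorem character_eq_of_inOrbit {ε : AddChar K ℂ} (hε : ε ≠ 1) (d : RookDatum n K)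
    {g h : unipotentGroup n K} (hgh : InOrbit (nilPart g) (nilPart h)) :
    d.character ε g = d.character ε h := by
  obtain ⟨a, b, hab⟩ := hgh
  rw [character_eq_sum hε, character_eq_sum hε, hab]
  refine congrArg (HMul.hMul _) (congrArg (HMul.hMul _) ?_)
  rw [← Equiv.sum_comp (Equiv.mulRight a)]
  refine Finset.sum_congr rfl fun x _ => ?_
  rw [← Equiv.sum_comp (Equiv.mulLeft b)]
  refine Finset.sum_congr rfl fun y _ => ?_
  simp [mul_assoc]

/-- The summand is `ε` of the difference of two translated forms. If that difference vanished on the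
radical, the orbits of the two forms would meet and the data would coincide. -/
theorem sum_mul_conj_eq_zero {ε : AddChar K ℂ} (hε : ε ≠ 1) {d d' : RookDatum n K}
    (hd : d ≠ d') (a b c e : unipotentGroup n K) :
    ∑ g : unipotentGroup n K,
      ε (d.functional ((a : (BorelContraction n K)ˣ) * nilPart g *
        (b : (BorelContraction n K)ˣ))) *
      (starRingEnd ℂ) (ε (d'.functional ((c : (BorelContraction n K)ˣ) * nilPart g *
        (e : (BorelContraction n K)ˣ)))) = 0 := by
  have h := sum_addChar_eq_zero hε
    (d.functionalLinear ∘ₗ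
        LinearMap.mulRight K ((b : (BorelContraction n K)ˣ) : BorelContraction n K)
        ∘ₗ LinearMap.mulLeft K ((a : (BorelContraction n K)ˣ) : BorelContraction n K) -
      d'.functionalLinear ∘ₗ
        LinearMap.mulRight K ((e : (BorelContraction n K)ˣ) : BorelContraction n K)
        ∘ₗ LinearMap.mulLeft K ((c : (BorelContraction n K)ˣ) : BorelContraction n K)) (by
    by_contra hcon
    push Not at hcon
    exact hd (eq_of_functional_eq a b c e fun X hX => sub_eq_zero.mp (hcon X hX)))
  rw [← h]
  refine Finset.sum_congr rfl fun g _ => ?_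
  rw [← AddChar.map_neg_eq_conj, ← AddChar.map_add_eq_mul, ← sub_eq_add_neg]
  rfl

theorem characterInner_character {ε : AddChar K ℂ} (hε : ε ≠ 1) {d d' : RookDatum n K}
    (hd : d ≠ d') : characterInner (d.character ε) (d'.character ε) = 0 := by
  rw [characterInner]
  simp only [character_eq_sum hε, map_mul, map_sum]
  rw [Finset.sum_congr rfl fun g _ => mul_mul_mul_comm _ _ _ _, ← Finset.mul_sum,
    Finset.sum_congr rfl fun g _ => mul_mul_mul_comm _ _ _ _, ← Finset.mul_sum]
  have h : ∑ g : unipotentGroup n K,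
      (∑ a : unipotentGroup n K, ∑ b : unipotentGroup n K,
        ε (d.functional ((a : (BorelContraction n K)ˣ) * nilPart g *
          (b : (BorelContraction n K)ˣ)))) *
      ∑ c : unipotentGroup n K, ∑ e : unipotentGroup n K,
        (starRingEnd ℂ) (ε (d'.functional ((c : (BorelContraction n K)ˣ) * nilPart g *
          (e : (BorelContraction n K)ˣ)))) = 0 := by
    simp only [Finset.sum_mul, Finset.mul_sum]
    rw [Finset.sum_comm]
    refine Finset.sum_eq_zero fun a _ => ?_
    rw [Finset.sum_comm]
    refine Finset.sum_eq_zero fun b _ => ?_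
    rw [Finset.sum_comm]
    refine Finset.sum_eq_zero fun c _ => ?_
    rw [Finset.sum_comm]
    exact Finset.sum_eq_zero fun e _ => sum_mul_conj_eq_zero hε hd _ _ _ _
  rw [h]
  simp

end RookDatum

theorem theorem3p7 (n : ℕ) (K : Type*) [Field K] [Finite K] (hK : ringChar K ≠ 2)
    (ε : AddChar K ℂ) (hε : ε ≠ 1) :
    IsSupercharacterTheory
      (fun d : RookDatum n K => d.character ε)
      (fun d : RookDatum n K => d.superclass) where
  isCharacter := RookDatum.isComplexCharacter_character ε
  nonempty := RookDatum.superclass_nonempty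
  disjoint _ _ := RookDatum.disjoint_superclass
  cover := RookDatum.iUnion_superclass
  orthogonal _ _ := RookDatum.characterInner_character hε
  constant d _ _ hg _ hh := d.character_eq_of_inOrbit hε
    (BorelContraction.InOrbit.trans (BorelContraction.InOrbit.symm hg) hh)
  one := RookDatum.exists_superclass_eq_one
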